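/- Let $X_1,X_2,\dots$ be i.i.d. real random variables on a probability space that are $1$-subgaussian, i.e. $\mathbb E[e^{aX_1}]\le e^{a^2/2}$ for all $a\in\mathbb R$ (in particular they are centered), and let $S_n=\sum_{i=1}^n X_i$, $S_0=0$. For $t>0$ and $x\in\mathbb R$ let $$V^S(t,x)=\sup_\tau \mathbb E\left[\frac{x+S_\tau}{t+\tau}\right],$$ where the supremum is over all stopping times $\tau$ of the natural filtration of $S$ with values in $\mathbb N_0\cup\{\infty\}$, and the reward on $\{\tau=\infty\}$ is $0$, the almost sure limit of $(x+S_n)/(t+n)$. Let $D^S=\{(t,x): t>0,\ V^S(t,x)=x/t\}$ be the stopping set, and let $\mathrm{erf}(z)=\frac{2}{\sqrt\pi}\int_0^z e^{-u^2}\,du$. Then the equation $$\sqrt{2\pi}\,(1-\alpha^2)\,e^{\alpha^2/2}\left(\mathrm{erf}\left(\alpha/\sqrt2\right)+1\right)=2\alpha$$ has a unique real solution $\alpha$, and the following holds for all $t>0$ and $x\in\mathbb R$. 1. The reward $(x+S_\tau)/(t+\tau)$ is integrable for every stopping time $\tau$. 2. If $X_1$ is not almost surely $0$, or if $x\ge 0$,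 then the stopping problem has an optimal stopping time (one that attains the supremum $V^S(t,x)$) that is almost surely finite; in fact the first entrance time $\tau_{D^S}=\inf\{n\ge0: (t+n,x+S_n)\in D^S\}$ into the stopping set is such a stopping time. 3. With $\tau'=\inf\{n>0: x+S_n\ge\alpha\sqrt{t+n}\}$ one has $\tau_{D^S}\le\tau'$, and if $X_1$ is not almost surely $0$, then $\tau'<\infty$ almost surely. (Here $\inf\emptyset=\infty$.) -/

import Mathlib

open MeasureTheory ProbabilityTheory

namespace ChowRobbins

/-- The error function `erf z = (2 / √π) ∫₀^z e^{-u²} du`. -/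
noncomputable def erf (z : ℝ) : ℝ :=
  2 / √Real.pi * ∫ u in (0 : ℝ)..z, Real.exp (-u ^ 2)

/-- The equation that determines the constant `α ≈ 0.8399`. -/
def IsBoundaryConstant (α : ℝ) : Prop :=
  √(2 * Real.pi) * (1 - α ^ 2) * Real.exp (α ^ 2 / 2) * (erf (α / √2) + 1) = 2 * α

variable {Ω : Type*}

/-- The random walk `S_n`, the sum of the first `n` increments; `X 0` is the first increment. -/
def walk (X : ℕ → Ω → ℝ) (n : ℕ) (ω : Ω) : ℝ :=
  ∑ i ∈ Finset.range n, X i ω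

/-- The reward `(x + S_τ) / (t + τ)`. On `{τ = ∞}` it is `0`, the almost sure limit of
`(x + S_n) / (t + n)` for centered i.i.d. increments. -/
noncomputable def reward (X : ℕ → Ω → ℝ) (t x : ℝ) (τ : Ω → WithTop ℕ) (ω : Ω) : ℝ :=
  match τ ω with
  | ⊤ => 0
  | (n : ℕ) => (x + walk X n ω) / (t + n)

/-- The time-space process `(t + n, x + S_n)`. -/
def timeSpace (X : ℕ → Ω → ℝ) (t x : ℝ) (n : ℕ) (ω : Ω) : ℝ × ℝ :=
  (t + n, x + walk X n ω)

/-- The time `inf {n > 0 | x + S_n ≥ α √(t + n)}`, which is `∞` if there is no such `n`. -/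
noncomputable def boundaryTime (X : ℕ → Ω → ℝ) (α t x : ℝ) : Ω → WithTop ℕ :=
  hittingAfter (timeSpace X t x) {p : ℝ × ℝ | α * √p.1 ≤ p.2} 1

variable {mΩ : MeasurableSpace Ω}

theorem measurable_walk {X : ℕ → Ω → ℝ} (hX : ∀ i, Measurable (X i)) (n : ℕ) :
    Measurable (walk X n) :=
  Finset.measurable_fun_sum _ fun i _ => hX i

/-- The natural filtration of the random walk. -/
def walkFiltration {X : ℕ → Ω → ℝ} (hX : ∀ i, Measurable (X i)) : Filtration ℕ mΩ :=
  Filtration.natural (walk X) fun n => (measurable_walk hX n).stronglyMeasurable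

/-- The value function `V^S(t, x) = sup_τ E[(x + S_τ) / (t + τ)]`, the supremum being over all
stopping times of the random walk, with values in `ℕ ∪ {∞}`. It is taken in the extended reals. -/
noncomputable def value {X : ℕ → Ω → ℝ} (hX : ∀ i, Measurable (X i)) (P : Measure Ω)
    (t x : ℝ) : EReal :=
  ⨆ (τ : Ω → WithTop ℕ) (_ : IsStoppingTime (walkFiltration hX) τ),
    ((∫ ω, reward X t x τ ω ∂P : ℝ) : EReal)

/-- `τ` solves the stopping problem started at `(t, x)`: it attains the supremum. -/
def IsOptimal {X : ℕ → Ω → ℝ} (hX : ∀ i, Measurable (X i)) (P : Measure Ω)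
    (t x : ℝ) (τ : Ω → WithTop ℕ) : Prop :=
  IsStoppingTime (walkFiltration hX) τ ∧ ((∫ ω, reward X t x τ ω ∂P : ℝ) : EReal) = value hX P t x

/-- The stopping set `D^S`, the points `(t, x)` with `t > 0` and `V^S(t, x) = x / t`. -/
def stoppingSet {X : ℕ → Ω → ℝ} (hX : ∀ i, Measurable (X i)) (P : Measure Ω) : Set (ℝ × ℝ) :=
  {p | 0 < p.1 ∧ value hX P p.1 p.2 = ((p.2 / p.1 : ℝ) : EReal)}

/-- The first entrance time `inf {n ≥ 0 | (t + n, x + S_n) ∈ D^S}` into the stopping set, which is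
`∞` if there is no such `n`. -/
noncomputable def entranceTime {X : ℕ → Ω → ℝ} (hX : ∀ i, Measurable (X i)) (P : Measure Ω)
    (t x : ℝ) : Ω → WithTop ℕ :=
  hittingAfter (timeSpace X t x) (stoppingSet hX P) 0

end ChowRobbins

/-!
The stopping problem is compared with the one for Brownian motion through an explicit
supermartingale. For `α` the boundary constant let
`F (t, x) = (1 - α²) ∫₀^∞ exp (l x - t l² / 2) dl`. Since `E exp (l X₁) ≤ exp (l² / 2)`, the process
`F (t + n, x + S_n)` is a supermartingale (`integral_gaussTransform_le`). In `x` the function `F` is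
convex, and the equation for `α` says that its tangent at `x = α √t` is the reward `x / t`; hence
`x / t ≤ F (t, x)` everywhere (`IsBoundaryConstant.div_le`), with equality on the boundary
(`IsBoundaryConstant.mul_gaussTransform_le`). The first inequality also shows that the equation has
only one solution.

The value function is constructed by backward induction, as the limit `limitValue` of the values
with finite horizon. It lies between `x / t` and `F`, satisfies the dynamic programming equation,
and its slope in `x` is at most that of the reward. So stopping is optimal at every point with
`α √t ≤ x` (`limitValue_eq_div_of_boundary_le`), which gives `τ_D ≤ τ'`, and elsewhere `limitValue`
is at most `α / √t`, which tends to `0` with growing `t` (`limitValue_le_of_ne`).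

For a stopping time `τ`, the expected value of following `τ` up to the time `n` and being paid
`limitValue` then (`truncatedValue`) is nonincreasing in `n`. The rewards have an integrable common
bound and tend to `0`, so no `τ` earns more than `limitValue` (`integral_reward_le`). If `τ` is the
first time at which the reward equals `limitValue`, the truncated values are constant, and what is
still to be paid at the time `n` is at most `α / √(t + n)`, so `τ` attains `limitValue`
(`integral_reward_eq`). This identifies `limitValue` with the value function and `τ` with the first
entrance time into the stopping set. No almost sure finiteness is needed for this.

Finiteness for nondegenerate steps follows from `limsup S_n / √n = ∞`, a consequence of the central
limit theorem and the Kolmogorov zero-one law (`ae_frequently_lt_walk`). For steps that vanish and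
`0 ≤ x`, stopping at once is optimal.
-/

namespace ChowRobbins

open Set Filter Topology

/-! ### The truncated Gaussian transform -/

/-- The integral `∫₀^∞ exp (l x - t l² / 2) dl`. A multiple of it is the value function of the
stopping problem for Brownian motion below the boundary `x = α √t`. -/
noncomputable def gaussTransform (t x : ℝ) : ℝ :=
  ∫ l in Ioi (0 : ℝ), Real.exp (l * x - t * l ^ 2 / 2)

theorem exp_quadratic_eq {t : ℝ} (ht : 0 < t) (x l : ℝ) :
    Real.exp (l * x - t * l ^ 2 / 2) =
      Real.exp (x ^ 2 / (2 * t)) * Real.exp (-(t / 2) * (l - x / t) ^ 2) := by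
  rw [← Real.exp_add]
  congr 1
  field_simp
  ring

theorem integrable_exp_quadratic {t : ℝ} (ht : 0 < t) (x : ℝ) :
    Integrable fun l : ℝ => Real.exp (l * x - t * l ^ 2 / 2) := by
  simp_rw [exp_quadratic_eq ht]
  exact ((integrable_exp_neg_mul_sq (by positivity : 0 < t / 2)).comp_sub_right (x / t)).const_mul _

theorem integrable_mul_exp_quadratic {t : ℝ} (ht : 0 < t) (x : ℝ) :
    Integrable fun l : ℝ => l * Real.exp (l * x - t * l ^ 2 / 2) := by
  have h1 := ((integrable_mul_exp_neg_mul_sq (by positivity : 0 < t / 2)).comp_sub_right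
    (x / t)).const_mul (Real.exp (x ^ 2 / (2 * t)))
  have h2 := (integrable_exp_quadratic ht x).const_mul (x / t)
  refine (h1.add h2).congr (ae_of_all _ fun l => ?_)
  simp only [Pi.add_apply]
  rw [exp_quadratic_eq ht]
  ring

theorem tendsto_exp_quadratic {t : ℝ} (ht : 0 < t) (x : ℝ) :
    Tendsto (fun l : ℝ => Real.exp (l * x - t * l ^ 2 / 2)) atTop (𝓝 0) := by
  refine Real.tendsto_exp_atBot.comp ?_
  have h1 : Tendsto (fun l : ℝ => x + (-(t / 2)) * l) atTop atBot :=
    tendsto_atBot_add_const_left _ _ (tendsto_id.const_mul_atTop_of_neg (by linarith))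
  refine (tendsto_id.atTop_mul_atBot₀ h1).congr fun l => ?_
  simp only [id]
  ring

/-- Integration of the derivative of `exp (l x - t l² / 2)` over the half line. -/
theorem integral_mul_exp_quadratic {t : ℝ} (ht : 0 < t) (x : ℝ) :
    t * ∫ l in Ioi (0 : ℝ), l * Real.exp (l * x - t * l ^ 2 / 2) =
      1 + x * gaussTransform t x := by
  have hd : ∀ l ∈ Ici (0 : ℝ), HasDerivAt (fun l : ℝ => Real.exp (l * x - t * l ^ 2 / 2))
      (x * Real.exp (l * x - t * l ^ 2 / 2) - t * (l * Real.exp (l * x - t * l ^ 2 / 2))) l := by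
    intro l _
    have h : HasDerivAt (fun l : ℝ => l * x - t * l ^ 2 / 2) (x - t * l) l := by
      have h1 := (hasDerivAt_id l).mul_const x
      have h2 := (((hasDerivAt_id l).pow 2).const_mul t).div_const 2
      refine (h1.sub h2).congr_deriv ?_
      simp
      ring
    refine h.exp.congr_deriv ?_
    ring
  have hi1 := ((integrable_exp_quadratic ht x).const_mul x).integrableOn (s := Ioi (0 : ℝ))
  have hi2 := ((integrable_mul_exp_quadratic ht x).const_mul t).integrableOn (s := Ioi (0 : ℝ))
  have h := integral_Ioi_of_hasDerivAt_of_tendsto' hd (hi1.sub hi2) (tendsto_exp_quadratic ht x)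
  rw [integral_sub hi1 hi2, integral_const_mul, integral_const_mul] at h
  simp only [zero_mul, ne_eq, OfNat.ofNat_ne_zero, not_false_eq_true, zero_pow, mul_zero, zero_div,
    sub_zero, Real.exp_zero] at h
  rw [gaussTransform]
  linarith

theorem gaussTransform_pos {t : ℝ} (ht : 0 < t) (x : ℝ) : 0 < gaussTransform t x := by
  refine (setIntegral_pos_iff_support_of_nonneg_ae ?_
    (integrable_exp_quadratic ht x).integrableOn).2 ?_
  · exact ae_of_all _ fun l => (Real.exp_pos _).le
  · have : Function.support (fun l : ℝ => Real.exp (l * x - t * l ^ 2 / 2)) = univ := by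
      ext l
      simp [(Real.exp_pos _).ne']
    rw [this, univ_inter, Real.volume_Ioi]
    exact ENNReal.zero_lt_top

theorem gaussTransform_mono {t : ℝ} (ht : 0 < t) : Monotone (gaussTransform t) := by
  intro x y hxy
  refine setIntegral_mono_on (integrable_exp_quadratic ht x).integrableOn
    (integrable_exp_quadratic ht y).integrableOn measurableSet_Ioi fun l hl => ?_
  have : l * x ≤ l * y := mul_le_mul_of_nonneg_left hxy (le_of_lt hl)
  gcongr

/-- The transform is convex in `x`: it lies above its tangent at `b`. -/
theorem tangent_le_gaussTransform {t : ℝ} (ht : 0 < t) (b x : ℝ) :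
    gaussTransform t b + (x - b) * ((1 + b * gaussTransform t b) / t) ≤ gaussTransform t x := by
  have hi1 := (integrable_exp_quadratic ht b).integrableOn (s := Ioi (0 : ℝ))
  have hi2 := ((integrable_mul_exp_quadratic ht b).const_mul (x - b)).integrableOn
    (s := Ioi (0 : ℝ))
  have hm : (1 + b * gaussTransform t b) / t =
      ∫ l in Ioi (0 : ℝ), l * Real.exp (l * b - t * l ^ 2 / 2) := by
    rw [← integral_mul_exp_quadratic ht b, mul_div_cancel_left₀ _ ht.ne']
  rw [hm, ← integral_const_mul, gaussTransform, ← integral_add hi1 hi2, gaussTransform]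
  refine setIntegral_mono_on (hi1.add hi2)
    (integrable_exp_quadratic ht x).integrableOn measurableSet_Ioi fun l _ => ?_
  have h1 : Real.exp (l * x - t * l ^ 2 / 2) =
      Real.exp (l * (x - b)) * Real.exp (l * b - t * l ^ 2 / 2) := by
    rw [← Real.exp_add]; ring_nf
  have h2 := Real.add_one_le_exp (l * (x - b))
  rw [h1]
  nlinarith [Real.exp_pos (l * b - t * l ^ 2 / 2)]

theorem gaussTransform_mul_sqrt {t : ℝ} (ht : 0 < t) (a : ℝ) :
    gaussTransform t (a * √t) = gaussTransform 1 a / √t := by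
  have hs : 0 < √t := Real.sqrt_pos.2 ht
  have h := integral_comp_mul_left_Ioi (fun l : ℝ => Real.exp (l * a - 1 * l ^ 2 / 2)) 0 hs
  rw [mul_zero, smul_eq_mul] at h
  rw [gaussTransform, gaussTransform, div_eq_inv_mul, ← h]
  refine integral_congr_ae (ae_of_all _ fun l => ?_)
  simp only
  rw [mul_pow, Real.sq_sqrt ht.le]
  ring_nf

/-- The supermartingale inequality: the moment generating function of a `c`-subgaussian
step is at most the inverse of the factor `exp (-c l² / 2)` that the time `c` costs. -/
theorem integral_gaussTransform_le {μ : Measure ℝ} {c : NNReal} [IsProbabilityMeasure μ]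
    (hμ : HasSubgaussianMGF id c μ) {t : ℝ} (ht : 0 < t) (x : ℝ) :
    Integrable (fun y => gaussTransform (t + c) (x + y)) μ ∧
      ∫ y, gaussTransform (t + c) (x + y) ∂μ ≤ gaussTransform t x := by
  set ν := (volume : Measure ℝ).restrict (Ioi (0 : ℝ)) with hν
  let f : ℝ × ℝ → ℝ := fun p => Real.exp (p.2 * (x + p.1) - (t + c) * p.2 ^ 2 / 2)
  have hfc : Continuous f := by fun_prop
  have hfe : ∀ y l, f (y, l) = Real.exp (l * x - (t + c) * l ^ 2 / 2) * Real.exp (l * id y) := by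
    intro y l
    simp only [f, id]
    rw [← Real.exp_add]
    ring_nf
  have hle : ∀ l, ∫ y, f (y, l) ∂μ ≤ Real.exp (l * x - t * l ^ 2 / 2) := by
    intro l
    simp_rw [hfe]
    rw [integral_const_mul]
    have h := hμ.mgf_le l
    simp only [mgf] at h
    calc _ ≤ Real.exp (l * x - (t + c) * l ^ 2 / 2) * Real.exp (c * l ^ 2 / 2) := by gcongr
      _ = _ := by rw [← Real.exp_add]; ring_nf
  have hint : Integrable f (μ.prod ν) := by
    refine (integrable_prod_iff' hfc.aestronglyMeasurable).2 ⟨ae_of_all _ fun l => ?_, ?_⟩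
    · simp_rw [hfe]
      exact (hμ.integrable_exp_mul l).const_mul _
    · have hn : ∀ l y, ‖f (y, l)‖ = f (y, l) := fun l y =>
        Real.norm_of_nonneg (Real.exp_pos _).le
      simp_rw [hn]
      refine Integrable.mono' (integrable_exp_quadratic ht x).integrableOn ?_
        (ae_of_all _ fun l => ?_)
      · exact (hfc.stronglyMeasurable.integral_prod_left).aestronglyMeasurable
      · rw [Real.norm_of_nonneg (integral_nonneg fun y => (Real.exp_pos _).le)]
        exact hle l
  refine ⟨hint.integral_prod_left, ?_⟩
  have hsw := integral_integral_swap (f := fun y l => f (y, l)) hint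
  calc ∫ y, gaussTransform (t + c) (x + y) ∂μ = ∫ l, ∫ y, f (y, l) ∂μ ∂ν := hsw
    _ ≤ gaussTransform t x :=
      integral_mono hint.integral_prod_right (integrable_exp_quadratic ht x).integrableOn hle

/-! ### The boundary constant -/

theorem gaussTransform_one (a : ℝ) :
    gaussTransform 1 a = √(Real.pi / 2) * Real.exp (a ^ 2 / 2) * (erf (a / √2) + 1) := by
  have h2 : (0 : ℝ) < √2 := by positivity
  have hsq : √2 ^ 2 = (2 : ℝ) := Real.sq_sqrt (by norm_num)
  set c := a / √2 with hc
  have hca : √2 * c = a := by rw [hc]; field_simp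
  have h := integral_comp_mul_left_Ioi (fun l : ℝ => Real.exp (l * a - 1 * l ^ 2 / 2)) 0 h2
  rw [mul_zero, smul_eq_mul] at h
  have hf : ∀ v : ℝ, Real.exp (√2 * v * a - 1 * (√2 * v) ^ 2 / 2) =
      Real.exp (a ^ 2 / 2) * Real.exp (-(v - c) ^ 2) := by
    intro v
    rw [← Real.exp_add, mul_pow, hsq, ← hca, mul_pow, hsq]
    congr 1
    linear_combination v * c * hsq
  have hg : Integrable fun u : ℝ => Real.exp (-u ^ 2) := by
    simpa using integrable_exp_neg_mul_sq (b := 1) one_pos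
  have hshift : ∫ v in Ioi (0 : ℝ), Real.exp (-(v - c) ^ 2) =
      ∫ u in Ioi (-c), Real.exp (-u ^ 2) := by
    have := (measurePreserving_sub_right volume c).setIntegral_preimage_emb
      (measurableEmbedding_subRight c) (fun u => Real.exp (-u ^ 2)) (Ioi (-c))
    rw [← this]
    congr 2
    ext v
    simp
  have hsplit := intervalIntegral.integral_interval_add_Ioi (a := -c) (b := 0)
    hg.integrableOn hg.integrableOn
  have hgauss : ∫ u in Ioi (0 : ℝ), Real.exp (-u ^ 2) = √Real.pi / 2 := by
    simpa using integral_gaussian_Ioi 1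
  have hneg : ∫ u in (-c)..0, Real.exp (-u ^ 2) = ∫ u in (0 : ℝ)..c, Real.exp (-u ^ 2) := by
    have := intervalIntegral.integral_comp_neg (a := 0) (b := c) fun u : ℝ => Real.exp (-u ^ 2)
    simp only [neg_sq, neg_zero] at this
    exact this.symm
  have herf : ∫ u in (0 : ℝ)..c, Real.exp (-u ^ 2) = √Real.pi / 2 * erf c := by
    rw [erf]
    have : 0 < √Real.pi := Real.sqrt_pos.2 Real.pi_pos
    field_simp
  simp_rw [hf] at h
  rw [integral_const_mul, hshift, ← hsplit, hneg, herf, hgauss] at h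
  have hpi : √(Real.pi / 2) * 2 = √2 * √Real.pi := by
    rw [Real.sqrt_div Real.pi_pos.le]
    field_simp
    rw [hsq]
  have h3 : gaussTransform 1 a =
      √2 * (Real.exp (a ^ 2 / 2) * (√Real.pi / 2 * erf c + √Real.pi / 2)) := by
    rw [h, gaussTransform]
    field_simp
  rw [h3]
  linear_combination -(Real.exp (a ^ 2 / 2) * (erf c + 1) / 2) * hpi

/-- The equation for the boundary constant says that `(1 - α²) ∫₀^∞ exp (l α - l² / 2) dl = α`,
the continuous fit at the boundary. -/
theorem isBoundaryConstant_iff (α : ℝ) :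
    IsBoundaryConstant α ↔ (1 - α ^ 2) * gaussTransform 1 α = α := by
  have h : √(2 * Real.pi) = 2 * √(Real.pi / 2) := by
    have : 2 * Real.pi = 2 ^ 2 * (Real.pi / 2) := by ring
    rw [this, Real.sqrt_mul (by norm_num), Real.sqrt_sq (by norm_num)]
  rw [IsBoundaryConstant, gaussTransform_one, h]
  constructor <;> intro h <;> linarith

theorem continuous_erf : Continuous erf := by
  have : Continuous fun u : ℝ => Real.exp (-u ^ 2) := by fun_prop
  exact (intervalIntegral.continuous_primitive (fun a b => this.intervalIntegrable a b) 0).const_mul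
    _

theorem IsBoundaryConstant.mem_Ioo {α : ℝ} (h : IsBoundaryConstant α) : α ∈ Ioo (0 : ℝ) 1 := by
  rw [isBoundaryConstant_iff] at h
  have hG := gaussTransform_pos one_pos α
  have hm : 0 ≤ 1 + α * gaussTransform 1 α := by
    rw [← integral_mul_exp_quadratic one_pos, one_mul]
    exact setIntegral_nonneg measurableSet_Ioi fun l hl =>
      mul_nonneg (le_of_lt hl) (Real.exp_pos _).le
  have hpos : 0 < α := by
    by_contra! hα
    -- the equation reads `G = α (1 + α G)`
    nlinarith [mul_nonneg (neg_nonneg.2 hα) hm]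
  refine ⟨hpos, ?_⟩
  by_contra! hα
  nlinarith [mul_nonneg (by nlinarith : 0 ≤ α ^ 2 - 1) hG.le]

/-- The value function `(1 - α²) ∫₀^∞ exp (l x - t l² / 2) dl` for Brownian motion dominates the
reward `x / t`, which is its tangent at the boundary point `x = α √t` (smooth fit). -/
theorem IsBoundaryConstant.div_le {α : ℝ} (h : IsBoundaryConstant α) {t : ℝ} (ht : 0 < t) (x : ℝ) :
    x / t ≤ (1 - α ^ 2) * gaussTransform t x := by
  obtain ⟨h0, h1⟩ := h.mem_Ioo
  rw [isBoundaryConstant_iff] at h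
  have hs : 0 < √t := Real.sqrt_pos.2 ht
  have hsq : √t ^ 2 = t := Real.sq_sqrt ht.le
  have key := mul_le_mul_of_nonneg_left (tangent_le_gaussTransform ht (α * √t) x)
    (by nlinarith : 0 ≤ 1 - α ^ 2)
  refine le_trans (le_of_eq ?_) key
  rw [gaussTransform_mul_sqrt ht]
  field_simp
  linear_combination -(t + α * √t * (x - α * √t)) * h + α * hsq

theorem IsBoundaryConstant.mul_gaussTransform_le {α : ℝ} (h : IsBoundaryConstant α) {t : ℝ}
    (ht : 0 < t) {x : ℝ} (hx : x ≤ α * √t) : (1 - α ^ 2) * gaussTransform t x ≤ α / √t := by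
  obtain ⟨h0, h1⟩ := h.mem_Ioo
  rw [isBoundaryConstant_iff] at h
  calc (1 - α ^ 2) * gaussTransform t x ≤ (1 - α ^ 2) * gaussTransform t (α * √t) :=
        mul_le_mul_of_nonneg_left (gaussTransform_mono ht hx) (by nlinarith)
    _ = α / √t := by rw [gaussTransform_mul_sqrt ht, mul_div_assoc', h]

theorem existsUnique_isBoundaryConstant : ∃! α : ℝ, IsBoundaryConstant α := by
  have hex : ∃ α, IsBoundaryConstant α := by
    have hc : ContinuousOn (fun α : ℝ =>
        √(2 * Real.pi) * (1 - α ^ 2) * Real.exp (α ^ 2 / 2) * (erf (α / √2) + 1) - 2 * α)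
        (Icc 0 1) := by
      have := continuous_erf
      fun_prop
    obtain ⟨α, -, hα⟩ := intermediate_value_Icc' zero_le_one hc (show (0 : ℝ) ∈ _ by
      simp [erf])
    exact ⟨α, sub_eq_zero.1 hα⟩
  -- the smaller of two solutions would put the tangent of the larger one above its transform
  have hlt : ∀ α β, IsBoundaryConstant α → IsBoundaryConstant β → ¬ α < β := by
    intro α β hα hβ hαβ
    have h1 := hβ.div_le one_pos α
    have h0 := hα.mem_Ioo.1
    rw [isBoundaryConstant_iff] at hα
    nlinarith [mul_pos (by nlinarith : 0 < β ^ 2 - α ^ 2) (gaussTransform_pos one_pos α)]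
  obtain ⟨α, hα⟩ := hex
  exact ⟨α, hα, fun β hβ => le_antisymm (not_lt.1 (hlt _ _ hα hβ)) (not_lt.1 (hlt _ _ hβ hα))⟩

/-! ### Backward induction -/

/-- The value of the stopping problem for steps of law `μ` when at most `k` steps are allowed,
computed by backward induction. -/
noncomputable def horizonValue (μ : Measure ℝ) : ℕ → ℝ → ℝ → ℝ
  | 0, t, x => x / t
  | k + 1, t, x => max (x / t) (∫ y, horizonValue μ k (t + 1) (x + y) ∂μ)

/-- The limit of the values with finite horizon. It is the value function of the stopping
problem. -/
noncomputable def limitValue (μ : Measure ℝ) (t x : ℝ) : ℝ :=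
  ⨆ k, horizonValue μ k t x

variable {μ : Measure ℝ}

theorem div_le_horizonValue (k : ℕ) (t x : ℝ) : x / t ≤ horizonValue μ k t x := by
  cases k
  · exact le_rfl
  · exact le_max_left _ _

variable [IsProbabilityMeasure μ]

theorem measurable_horizonValue (k : ℕ) (t : ℝ) : Measurable (horizonValue μ k t) := by
  induction k generalizing t with
  | zero => exact measurable_id.div_const t
  | succ k ih =>
    refine (measurable_id.div_const t).max ?_
    have h : StronglyMeasurable (Function.uncurry fun x y => horizonValue μ k (t + 1) (x + y)) :=
      ((ih (t + 1)).comp measurable_add).stronglyMeasurable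
    exact h.integral_prod_right.measurable

theorem measurable_limitValue (t : ℝ) : Measurable (limitValue μ t) :=
  Measurable.iSup fun k => measurable_horizonValue k t

/-- A measurable function between the reward and a multiple of the Gaussian transform is integrable
along a subgaussian step. -/
theorem integrable_of_div_le_of_le_gaussTransform (hμ : HasSubgaussianMGF id 1 μ) {t c : ℝ}
    (ht : 0 < t) {g : ℝ → ℝ} (hg : Measurable g) (hl : ∀ x, x / (t + 1) ≤ g x)
    (hu : ∀ x, g x ≤ c * gaussTransform (t + 1) x) (x : ℝ) :
    Integrable (fun y => g (x + y)) μ := by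
  have h1 : Integrable (fun y => (x + y) / (t + 1)) μ :=
    ((integrable_const x).add hμ.integrable).div_const _
  have h2 := (integral_gaussTransform_le hμ ht x).1.const_mul c
  rw [NNReal.coe_one] at h2
  exact integrable_of_le_of_le (hg.comp (measurable_const_add x)).aestronglyMeasurable
    (ae_of_all _ fun y => hl (x + y)) (ae_of_all _ fun y => hu (x + y)) h1 h2

theorem horizonValue_le (hμ : HasSubgaussianMGF id 1 μ) {α : ℝ} (hα : IsBoundaryConstant α)
    (k : ℕ) {t : ℝ} (ht : 0 < t) (x : ℝ) :
    horizonValue μ k t x ≤ (1 - α ^ 2) * gaussTransform t x := by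
  induction k generalizing t x with
  | zero => exact hα.div_le ht x
  | succ k ih =>
    have ht1 : 0 < t + 1 := by linarith
    obtain ⟨h0, h1⟩ := hα.mem_Ioo
    have hG := integral_gaussTransform_le hμ ht x
    rw [NNReal.coe_one] at hG
    refine max_le (hα.div_le ht x) ?_
    calc ∫ y, horizonValue μ k (t + 1) (x + y) ∂μ
        ≤ ∫ y, (1 - α ^ 2) * gaussTransform (t + 1) (x + y) ∂μ :=
          integral_mono (integrable_of_div_le_of_le_gaussTransform hμ ht
            (measurable_horizonValue k _) (div_le_horizonValue k _) (fun x => ih ht1 x) x)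
            (hG.1.const_mul _) fun y => ih ht1 _
      _ ≤ (1 - α ^ 2) * gaussTransform t x := by
          rw [integral_const_mul]
          exact mul_le_mul_of_nonneg_left hG.2 (by nlinarith)

theorem integrable_horizonValue (hμ : HasSubgaussianMGF id 1 μ) (k : ℕ) {t : ℝ} (ht : 0 < t)
    (x : ℝ) : Integrable (fun y => horizonValue μ k (t + 1) (x + y)) μ := by
  obtain ⟨α, hα, -⟩ := existsUnique_isBoundaryConstant
  exact integrable_of_div_le_of_le_gaussTransform hμ ht (measurable_horizonValue k _)
    (div_le_horizonValue k _) (horizonValue_le hμ hα k (by linarith)) x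

theorem horizonValue_le_succ (hμ : HasSubgaussianMGF id 1 μ) (k : ℕ) {t : ℝ} (ht : 0 < t) (x : ℝ) :
    horizonValue μ k t x ≤ horizonValue μ (k + 1) t x := by
  induction k generalizing t x with
  | zero => exact div_le_horizonValue 1 t x
  | succ k ih =>
    exact max_le_max le_rfl (integral_mono (integrable_horizonValue hμ k ht x)
      (integrable_horizonValue hμ (k + 1) ht x) fun y => ih (by linarith) _)

theorem horizonValue_le_add (hμ : HasSubgaussianMGF id 1 μ) (k : ℕ) {t : ℝ} (ht : 0 < t)
    {x x' : ℝ} (hx : x ≤ x') :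
    horizonValue μ k t x' ≤ horizonValue μ k t x + (x' - x) / t := by
  induction k generalizing t x x' with
  | zero =>
    simp only [horizonValue]
    rw [← add_div, add_sub_cancel]
  | succ k ih =>
    refine max_le ?_ ?_
    · calc x' / t = x / t + (x' - x) / t := by rw [← add_div, add_sub_cancel]
        _ ≤ _ := by gcongr; exact div_le_horizonValue (k + 1) t x
    · calc ∫ y, horizonValue μ k (t + 1) (x' + y) ∂μ
          ≤ ∫ y, (horizonValue μ k (t + 1) (x + y) + (x' - x) / (t + 1)) ∂μ := by
            refine integral_mono (integrable_horizonValue hμ k ht x')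
              ((integrable_horizonValue hμ k ht x).add (integrable_const _)) fun y => ?_
            have := ih (t := t + 1) (by linarith) (x := x + y) (x' := x' + y) (by linarith)
            rwa [add_sub_add_right_eq_sub] at this
        _ = (∫ y, horizonValue μ k (t + 1) (x + y) ∂μ) + (x' - x) / (t + 1) := by
            rw [integral_add (integrable_horizonValue hμ k ht x) (integrable_const _)]
            simp
        _ ≤ _ := by
            gcongr
            · exact le_max_right _ _
            · linarith

theorem tendsto_horizonValue (hμ : HasSubgaussianMGF id 1 μ) {t : ℝ} (ht : 0 < t) (x : ℝ) :
    Tendsto (fun k => horizonValue μ k t x) atTop (𝓝 (limitValue μ t x)) := by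
  obtain ⟨α, hα, -⟩ := existsUnique_isBoundaryConstant
  refine tendsto_atTop_ciSup (monotone_nat_of_le_succ fun k => horizonValue_le_succ hμ k ht x) ?_
  exact ⟨_, forall_mem_range.2 fun k => horizonValue_le hμ hα k ht x⟩

theorem div_le_limitValue (hμ : HasSubgaussianMGF id 1 μ) {t : ℝ} (ht : 0 < t) (x : ℝ) :
    x / t ≤ limitValue μ t x :=
  ge_of_tendsto' (tendsto_horizonValue hμ ht x) fun k => div_le_horizonValue k t x

theorem limitValue_le (hμ : HasSubgaussianMGF id 1 μ) {α : ℝ} (hα : IsBoundaryConstant α)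
    {t : ℝ} (ht : 0 < t) (x : ℝ) : limitValue μ t x ≤ (1 - α ^ 2) * gaussTransform t x :=
  le_of_tendsto' (tendsto_horizonValue hμ ht x) fun k => horizonValue_le hμ hα k ht x

theorem integrable_limitValue (hμ : HasSubgaussianMGF id 1 μ) {t : ℝ} (ht : 0 < t)
    (x : ℝ) : Integrable (fun y => limitValue μ (t + 1) (x + y)) μ := by
  obtain ⟨α, hα, -⟩ := existsUnique_isBoundaryConstant
  have ht1 : 0 < t + 1 := by linarith
  exact integrable_of_div_le_of_le_gaussTransform hμ ht (measurable_limitValue _)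
    (div_le_limitValue hμ ht1) (limitValue_le hμ hα ht1) x

/-- The dynamic programming equation. -/
theorem limitValue_eq_max (hμ : HasSubgaussianMGF id 1 μ) {t : ℝ} (ht : 0 < t) (x : ℝ) :
    limitValue μ t x = max (x / t) (∫ y, limitValue μ (t + 1) (x + y) ∂μ) := by
  have ht1 : 0 < t + 1 := by linarith
  have h1 := (tendsto_horizonValue hμ ht x).comp (tendsto_add_atTop_nat 1)
  have h2 : Tendsto (fun k => ∫ y, horizonValue μ k (t + 1) (x + y) ∂μ) atTop
      (𝓝 (∫ y, limitValue μ (t + 1) (x + y) ∂μ)) :=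
    integral_tendsto_of_tendsto_of_monotone (fun k => integrable_horizonValue hμ k ht x)
      (integrable_limitValue hμ ht x)
      (ae_of_all _ fun y => monotone_nat_of_le_succ fun k => horizonValue_le_succ hμ k ht1 _)
      (ae_of_all _ fun y => tendsto_horizonValue hμ ht1 _)
  exact tendsto_nhds_unique h1 (tendsto_const_nhds.max h2)

/-- If stopping is optimal at `(t, x)`, it is optimal at every `(t, x')` with `x ≤ x'`: the slope
in `x` of the value is at most the slope `1 / t` of the reward. -/
theorem limitValue_eq_div_mono (hμ : HasSubgaussianMGF id 1 μ) {t : ℝ} (ht : 0 < t) {x x' : ℝ}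
    (hx : x ≤ x') (h : limitValue μ t x = x / t) : limitValue μ t x' = x' / t := by
  refine le_antisymm ?_ (div_le_limitValue hμ ht x')
  have := le_of_tendsto_of_tendsto' (tendsto_horizonValue hμ ht x')
    ((tendsto_horizonValue hμ ht x).add_const _) fun k => horizonValue_le_add hμ k ht hx
  rwa [h, ← add_div, add_sub_cancel] at this

theorem limitValue_eq_div_of_boundary_le (hμ : HasSubgaussianMGF id 1 μ) {α : ℝ}
    (hα : IsBoundaryConstant α) {t : ℝ} (ht : 0 < t) {x : ℝ} (hx : α * √t ≤ x) :
    limitValue μ t x = x / t := by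
  refine limitValue_eq_div_mono hμ ht hx (le_antisymm ?_ (div_le_limitValue hμ ht _))
  refine (limitValue_le hμ hα ht _).trans ((hα.mul_gaussTransform_le ht le_rfl).trans_eq ?_)
  rw [mul_div_assoc, Real.sqrt_div_self', mul_one_div]

theorem limitValue_le_of_ne (hμ : HasSubgaussianMGF id 1 μ) {α : ℝ}
    (hα : IsBoundaryConstant α) {t : ℝ} (ht : 0 < t) {x : ℝ} (hx : limitValue μ t x ≠ x / t) :
    limitValue μ t x ≤ α / √t := by
  have hx' : x ≤ α * √t := by
    by_contra! h
    exact hx (limitValue_eq_div_of_boundary_le hμ hα ht h.le)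
  exact (limitValue_le hμ hα ht x).trans (hα.mul_gaussTransform_le ht hx')

/-! ### The random walk -/

variable {Ω : Type*} {mΩ : MeasurableSpace Ω} {P : Measure Ω} {X : ℕ → Ω → ℝ}

theorem integral_eq_zero_of_hasSubgaussianMGF [IsProbabilityMeasure P] {Y : Ω → ℝ} {c : NNReal}
    (h : HasSubgaussianMGF Y c P) : ∫ ω, Y ω ∂P = 0 := by
  set m := ∫ ω, Y ω ∂P with hm
  have hle : ∀ a : ℝ, a * m ≤ c * a ^ 2 / 2 := by
    intro a
    have hj := convexOn_exp.map_integral_le (μ := P) (f := fun ω => a * Y ω)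
      Real.continuous_exp.continuousOn isClosed_univ (ae_of_all _ fun _ => mem_univ _)
      (h.integrable.const_mul a) (h.integrable_exp_mul a)
    rw [integral_const_mul, ← hm] at hj
    exact Real.exp_le_exp.1 (hj.trans (h.mgf_le a))
  have h1 := hle (m / (c + 1))
  have hc : (0 : ℝ) < c + 1 := by positivity
  have h2 : m ^ 2 * (c + 1) ≤ c * m ^ 2 / 2 := by
    field_simp at h1
    nlinarith
  have h3 : m ^ 2 ≤ 0 := by nlinarith [mul_nonneg c.2 (sq_nonneg m), c.2]
  exact pow_eq_zero_iff two_ne_zero |>.1 (le_antisymm h3 (sq_nonneg m))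

theorem walk_succ (X : ℕ → Ω → ℝ) (n : ℕ) (ω : Ω) : walk X (n + 1) ω = walk X n ω + X n ω :=
  Finset.sum_range_succ _ _

@[simp]
theorem walk_zero (X : ℕ → Ω → ℝ) (ω : Ω) : walk X 0 ω = 0 :=
  Finset.sum_range_zero _

theorem hasSubgaussianMGF_walk (hindep : iIndepFun X P)
    (hident : ∀ i, IdentDistrib (X i) (X 0) P P) (hsub : HasSubgaussianMGF (X 0) 1 P) (n : ℕ) :
    HasSubgaussianMGF (walk X n) n P := by
  have h := HasSubgaussianMGF.sum_of_iIndepFun hindep (c := fun _ => 1) (s := Finset.range n)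
    fun i _ => hsub.congr_identDistrib (hident i).symm
  rw [Finset.sum_const, Finset.card_range, nsmul_one] at h
  exact h

theorem hasSubgaussianMGF_id_map [IsProbabilityMeasure P] (hX : ∀ i, Measurable (X i))
    (hsub : HasSubgaussianMGF (X 0) 1 P) : HasSubgaussianMGF id 1 (P.map (X 0)) :=
  (HasSubgaussianMGF.id_map_iff (hX 0).aemeasurable).2 hsub

theorem tendsto_walk_div [IsProbabilityMeasure P] (hindep : iIndepFun X P)
    (hident : ∀ i, IdentDistrib (X i) (X 0) P P) (hsub : HasSubgaussianMGF (X 0) 1 P) {t : ℝ}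
    (ht : 0 < t) (x : ℝ) :
    ∀ᵐ ω ∂P, Tendsto (fun n : ℕ => (x + walk X n ω) / (t + n)) atTop (𝓝 0) := by
  have h := strong_law_ae_real X hsub.integrable (fun i j hij => hindep.indepFun hij) hident
  rw [integral_eq_zero_of_hasSubgaussianMGF hsub] at h
  filter_upwards [h] with ω hω
  have hn : Tendsto (fun n : ℕ => (n : ℝ)) atTop atTop := tendsto_natCast_atTop_atTop
  have h1 : Tendsto (fun n : ℕ => x / (n : ℝ)) atTop (𝓝 0) := tendsto_const_nhds.div_atTop hn
  have h2 : Tendsto (fun n : ℕ => t / (n : ℝ)) atTop (𝓝 0) := tendsto_const_nhds.div_atTop hn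
  have h3 := (h1.add hω).div (h2.add_const 1) (by simp)
  simp only [add_zero, zero_add, div_one] at h3
  refine h3.congr' ?_
  filter_upwards [eventually_gt_atTop 0] with n hn0
  have : (0 : ℝ) < n := by exact_mod_cast hn0
  simp only [walk, Pi.div_apply]
  field_simp

theorem exists_integrable_bound {f : ℕ → Ω → ℝ} (h0 : ∀ n ω, 0 ≤ f n ω)
    (hf : ∀ n, Integrable (f n) P) (hs : Summable fun n => ∫ ω, f n ω ∂P) :
    ∃ M : Ω → ℝ, Integrable M P ∧ ∀ᵐ ω ∂P, ∀ n, f n ω ≤ M ω := by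
  have hm : ∀ n, AEMeasurable (fun ω => ENNReal.ofReal (f n ω)) P := fun n =>
    (hf n).aemeasurable.ennreal_ofReal
  have hsum : ∫⁻ ω, ∑' n, ENNReal.ofReal (f n ω) ∂P ≠ ⊤ := by
    rw [lintegral_tsum hm]
    simp_rw [← ofReal_integral_eq_lintegral_ofReal (hf _) (ae_of_all _ (h0 _))]
    rw [← ENNReal.ofReal_tsum_of_nonneg (fun n => integral_nonneg (h0 n)) hs]
    exact ENNReal.ofReal_ne_top
  have hmt : AEMeasurable (fun ω => ∑' n, ENNReal.ofReal (f n ω)) P := AEMeasurable.tsum hm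
  refine ⟨fun ω => (∑' n, ENNReal.ofReal (f n ω)).toReal,
    integrable_toReal_of_lintegral_ne_top hmt hsum, ?_⟩
  filter_upwards [ae_lt_top' hmt hsum] with ω hω n
  exact (ENNReal.ofReal_le_iff_le_toReal hω.ne).1 (ENNReal.le_tsum n)

/-- The rewards from stopping at deterministic times have an integrable common bound. The
exponential moments of `|S_n| - n` are summable, and they control `|S_n| / n`. -/
theorem exists_integrable_reward_bound [IsProbabilityMeasure P] (hindep : iIndepFun X P)
    (hident : ∀ i, IdentDistrib (X i) (X 0) P P) (hsub : HasSubgaussianMGF (X 0) 1 P) {t : ℝ}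
    (ht : 0 < t) (x : ℝ) :
    ∃ M : Ω → ℝ, Integrable M P ∧ ∀ᵐ ω ∂P, ∀ n : ℕ, |(x + walk X n ω) / (t + n)| ≤ M ω := by
  let f : ℕ → Ω → ℝ := fun n ω =>
    Real.exp (-n) * (Real.exp (1 * walk X n ω) + Real.exp ((-1) * walk X n ω))
  have hS := hasSubgaussianMGF_walk hindep hident hsub
  have hf : ∀ n, Integrable (f n) P := fun n =>
    (((hS n).integrable_exp_mul 1).add ((hS n).integrable_exp_mul (-1))).const_mul _
  have h0 : ∀ n ω, 0 ≤ f n ω := fun n ω => by positivity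
  have hle : ∀ n, ∫ ω, f n ω ∂P ≤ 2 * Real.exp (-(1 / 2)) ^ n := by
    intro n
    have h1 := (hS n).mgf_le 1
    have h2 := (hS n).mgf_le (-1)
    simp only [mgf, NNReal.coe_natCast, one_pow, mul_one, even_two, Even.neg_pow] at h1 h2
    simp only [f]
    rw [integral_const_mul,
      integral_add ((hS n).integrable_exp_mul 1) ((hS n).integrable_exp_mul (-1))]
    calc _ ≤ Real.exp (-n) * (Real.exp (n / 2) + Real.exp (n / 2)) := by gcongr
      _ = _ := by
        rw [← Real.exp_nat_mul, ← two_mul, mul_left_comm, ← Real.exp_add]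
        ring_nf
  have hs : Summable fun n => ∫ ω, f n ω ∂P := by
    refine Summable.of_nonneg_of_le (fun n => integral_nonneg (h0 n)) hle ?_
    exact (summable_geometric_of_lt_one (Real.exp_pos _).le
      (Real.exp_lt_one_iff.2 (by norm_num))).mul_left 2
  obtain ⟨M, hM, hb⟩ := exists_integrable_bound h0 hf hs
  refine ⟨fun ω => |x| / t + (1 + M ω), (integrable_const _).add ((integrable_const _).add hM), ?_⟩
  filter_upwards [hb] with ω hω n
  have hn : (0 : ℝ) ≤ n := n.cast_nonneg
  have htn : 0 < t + n := by linarith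
  have hexp : Real.exp (|walk X n ω| - n) ≤ M ω := by
    refine le_trans ?_ (hω n)
    simp only [f]
    rw [sub_eq_neg_add, Real.exp_add]
    gcongr
    simpa using Real.exp_abs_le (walk X n ω)
  have hw : |walk X n ω| / (t + n) ≤ 1 + M ω := by
    have hM0 : 0 ≤ M ω := (Real.exp_pos _).le.trans hexp
    rcases Nat.eq_zero_or_pos n with rfl | hpos
    · simp only [walk_zero, abs_zero, zero_div]
      linarith
    · have hn1 : (1 : ℝ) ≤ n := by exact_mod_cast hpos
      rw [div_le_iff₀ htn]
      have := Real.add_one_le_exp (|walk X n ω| - n)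
      nlinarith
  calc |(x + walk X n ω) / (t + n)| = |x + walk X n ω| / (t + n) := by
        rw [abs_div, abs_of_pos htn]
    _ ≤ (|x| + |walk X n ω|) / (t + n) := by gcongr; exact abs_add_le _ _
    _ = |x| / (t + n) + |walk X n ω| / (t + n) := add_div _ _ _
    _ ≤ |x| / t + (1 + M ω) := by
        gcongr
        linarith

/-! ### The Markov property -/

theorem indep_walkFiltration [IsProbabilityMeasure P] (hX : ∀ i, Measurable (X i))
    (hindep : iIndepFun X P) (n : ℕ) :
    Indep (walkFiltration hX n) (MeasurableSpace.comap (X n) inferInstance) P := by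
  have h := indep_iSup_of_disjoint (fun i => (hX i).comap_le) hindep.iIndep
    (S := Iio n) (T := {n}) (by simp)
  simp only [mem_singleton_iff, iSup_iSup_eq_left] at h
  refine indep_of_indep_of_le_left h (iSup₂_le fun j hj => ?_)
  rw [← measurable_iff_comap_le]
  refine Finset.measurable_fun_sum _ fun i hi => measurable_iff_comap_le.2 ?_
  have hin : i < n := (Finset.mem_range.1 hi).trans_le hj
  exact le_iSup₂ (f := fun i (_ : i ∈ Iio n) => MeasurableSpace.comap (X i) _) i hin

/-- The Markov property: on an event of the first `n` steps, the next step is integrated out against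
the law of a single step. -/
theorem setIntegral_walk_succ [IsProbabilityMeasure P] (hX : ∀ i, Measurable (X i))
    (hindep : iIndepFun X P) (hident : ∀ i, IdentDistrib (X i) (X 0) P P) {n : ℕ} {A : Set Ω}
    (hA : MeasurableSet[walkFiltration hX n] A) {g : ℝ → ℝ} (hg : Measurable g) (x : ℝ)
    (hi : Integrable (fun ω => g (x + walk X (n + 1) ω)) P) :
    IntegrableOn (fun ω => ∫ y, g (x + walk X n ω + y) ∂(P.map (X 0))) A P ∧
    ∫ ω in A, g (x + walk X (n + 1) ω) ∂P =
      ∫ ω in A, ∫ y, g (x + walk X n ω + y) ∂(P.map (X 0)) ∂P := by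
  have hA' : MeasurableSet A := (walkFiltration hX).le n A hA
  have hS : Measurable[walkFiltration hX n] (walk X n) :=
    measurable_iff_comap_le.2 (le_iSup₂_of_le n le_rfl le_rfl)
  let Y : Ω → ℝ × ℝ := fun ω => (A.indicator (fun _ => (1 : ℝ)) ω, walk X n ω)
  have hY : Measurable[walkFiltration hX n] Y := (measurable_const.indicator hA).prodMk hS
  have hY' : Measurable Y := hY.mono ((walkFiltration hX).le n) le_rfl
  have hYX : IndepFun Y (X n) P := by
    rw [IndepFun_iff_Indep]
    exact indep_of_indep_of_le_left (indep_walkFiltration hX hindep n)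
      (measurable_iff_comap_le.1 hY)
  have hmap := (indepFun_iff_map_prod_eq_prod_map_map hY'.aemeasurable (hX n).aemeasurable).1 hYX
  rw [(hident n).map_eq] at hmap
  have : IsProbabilityMeasure (P.map (X 0)) := Measure.isProbabilityMeasure_map (hX 0).aemeasurable
  let h : (ℝ × ℝ) × ℝ → ℝ := fun p => p.1.1 * g (x + p.1.2 + p.2)
  have hh : Measurable h := by
    have : Measurable fun p : (ℝ × ℝ) × ℝ => x + p.1.2 + p.2 := by fun_prop
    exact measurable_fst.fst.mul (hg.comp this)
  have hYX' : Measurable fun ω => (Y ω, X n ω) := hY'.prodMk (hX n)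
  have hhω : ∀ ω, h (Y ω, X n ω) = A.indicator (fun ω => g (x + walk X (n + 1) ω)) ω := by
    intro ω
    simp only [h, Y, walk_succ, add_assoc]
    by_cases hω : ω ∈ A <;> simp [hω]
  have hint : Integrable h ((P.map Y).prod (P.map (X 0))) := by
    rw [← hmap, integrable_map_measure hh.aestronglyMeasurable hYX'.aemeasurable]
    exact (hi.indicator hA').congr (ae_of_all _ fun ω => (hhω ω).symm)
  have hsec : ∀ ω, ∫ y, h (Y ω, y) ∂(P.map (X 0)) =
      A.indicator (fun ω => ∫ y, g (x + walk X n ω + y) ∂(P.map (X 0))) ω := by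
    intro ω
    simp only [h, Y]
    by_cases hω : ω ∈ A <;> simp [hω]
  refine ⟨(integrable_indicator_iff hA').1 ((hint.integral_prod_left.comp_measurable hY').congr
    (ae_of_all _ hsec)), ?_⟩
  calc ∫ ω in A, g (x + walk X (n + 1) ω) ∂P = ∫ ω, h (Y ω, X n ω) ∂P := by
        rw [← integral_indicator hA']
        exact integral_congr_ae (ae_of_all _ fun ω => (hhω ω).symm)
    _ = ∫ p, h p ∂((P.map Y).prod (P.map (X 0))) := by
        rw [← hmap, integral_map hYX'.aemeasurable hh.aestronglyMeasurable]
    _ = ∫ z, ∫ y, h (z, y) ∂(P.map (X 0)) ∂(P.map Y) := integral_prod _ hint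
    _ = ∫ ω, ∫ y, h (Y ω, y) ∂(P.map (X 0)) ∂P :=
        integral_map hY'.aemeasurable hint.integral_prod_left.aestronglyMeasurable
    _ = _ := by
        rw [← integral_indicator hA']
        exact integral_congr_ae (ae_of_all _ hsec)

theorem integrable_limitValue_walk [IsProbabilityMeasure P] (hX : ∀ i, Measurable (X i))
    (hindep : iIndepFun X P) (hident : ∀ i, IdentDistrib (X i) (X 0) P P)
    (hsub : HasSubgaussianMGF (X 0) 1 P) {t : ℝ} (ht : 0 < t) (x : ℝ) (n : ℕ) :
    Integrable (fun ω => limitValue (P.map (X 0)) (t + n) (x + walk X n ω)) P := by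
  have : IsProbabilityMeasure (P.map (X 0)) := Measure.isProbabilityMeasure_map (hX 0).aemeasurable
  have hS := hasSubgaussianMGF_walk hindep hident hsub n
  have hSm := measurable_walk hX n
  have : IsProbabilityMeasure (P.map (walk X n)) := Measure.isProbabilityMeasure_map
    hSm.aemeasurable
  have hμ := hasSubgaussianMGF_id_map hX hsub
  have hG := (integral_gaussTransform_le
    ((HasSubgaussianMGF.id_map_iff hSm.aemeasurable).2 hS) ht x).1.comp_measurable hSm
  rw [NNReal.coe_natCast] at hG
  obtain ⟨α, hα, -⟩ := existsUnique_isBoundaryConstant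
  have htn : 0 < t + n := by positivity
  refine integrable_of_le_of_le
    ((measurable_limitValue _).comp (hSm.const_add x)).aestronglyMeasurable
    (ae_of_all _ fun ω => div_le_limitValue hμ htn _)
    (ae_of_all _ fun ω => limitValue_le hμ hα htn _) ?_ (hG.const_mul _)
  exact ((integrable_const x).add hS.integrable).div_const _

/-! ### Stopping -/

theorem reward_of_eq {τ : Ω → WithTop ℕ} {ω : Ω} {n : ℕ} (h : τ ω = WithTop.some n) (t x : ℝ) :
    reward X t x τ ω = (x + walk X n ω) / (t + n) := by
  rw [reward, h]

theorem reward_of_eq_top {τ : Ω → WithTop ℕ} {ω : Ω} (h : τ ω = ⊤) (t x : ℝ) :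
    reward X t x τ ω = 0 := by
  rw [reward, h]

theorem setOf_le_succ (τ : Ω → WithTop ℕ) (n : ℕ) :
    {ω | τ ω ≤ WithTop.some (n + 1)} =
      {ω | τ ω ≤ WithTop.some n} ∪ {ω | τ ω = WithTop.some (n + 1)} := by
  ext ω
  simp only [mem_ofPred_eq, mem_union]
  cases τ ω with
  | top => simp only [top_le_iff, WithTop.coe_ne_top, WithTop.top_ne_coe, or_self]
  | coe k =>
    rw [WithTop.coe_le_coe, WithTop.coe_le_coe, WithTop.coe_inj]
    omega

theorem disjoint_setOf_le (τ : Ω → WithTop ℕ) (n : ℕ) :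
    Disjoint {ω | τ ω ≤ WithTop.some n} {ω | τ ω = WithTop.some (n + 1)} := by
  rw [Set.disjoint_left]
  intro ω h1 h2
  simp only [mem_ofPred_eq] at h1 h2
  rw [h2, WithTop.coe_le_coe] at h1
  omega

theorem tendsto_indicator_reward (τ : Ω → WithTop ℕ) (t x : ℝ) (ω : Ω) :
    Tendsto (fun n : ℕ => {ω | τ ω ≤ WithTop.some n}.indicator (reward X t x τ) ω) atTop
      (𝓝 (reward X t x τ ω)) := by
  cases h : τ ω with
  | top =>
    rw [reward_of_eq_top h]
    refine tendsto_const_nhds.congr fun n => ?_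
    rw [indicator_of_notMem]
    simp [h]
  | coe k =>
    refine tendsto_const_nhds.congr' ?_
    filter_upwards [eventually_ge_atTop k] with n hn
    rw [indicator_of_mem]
    simp only [mem_ofPred_eq, h]
    exact WithTop.coe_le_coe.2 hn

section StoppingTime

variable {hX : ∀ i, Measurable (X i)} {τ : Ω → WithTop ℕ}

theorem measurableSet_le (hτ : IsStoppingTime (walkFiltration hX) τ) (n : ℕ) :
    MeasurableSet {ω | τ ω ≤ WithTop.some n} :=
  (walkFiltration hX).le n _ (hτ n)

theorem measurableSet_eq (hτ : IsStoppingTime (walkFiltration hX) τ) (n : ℕ) :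
    MeasurableSet {ω | τ ω = WithTop.some n} :=
  (walkFiltration hX).le n _ (hτ.measurableSet_eq n)

theorem measurable_reward (hτ : IsStoppingTime (walkFiltration hX) τ) (t x : ℝ) :
    Measurable (reward X t x τ) := by
  have hr : ∀ n : ℕ, {ω | τ ω = WithTop.some n}.indicator (reward X t x τ) =
      {ω | τ ω = WithTop.some n}.indicator fun ω => (x + walk X n ω) / (t + n) := fun n =>
    indicator_congr fun ω hω => reward_of_eq hω t x
  have hm : ∀ n : ℕ, Measurable ({ω | τ ω = WithTop.some n}.indicator (reward X t x τ)) := by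
    intro n
    rw [hr n]
    exact (((measurable_walk hX n).const_add x).div_const _).indicator (measurableSet_eq hτ n)
  refine measurable_of_tendsto_metrizable (f := fun n : ℕ => {ω | τ ω ≤ WithTop.some n}.indicator
    (reward X t x τ)) (fun n => ?_) (tendsto_pi_nhds.2 (tendsto_indicator_reward τ t x))
  induction n with
  | zero =>
    have : {ω | τ ω ≤ WithTop.some 0} = {ω | τ ω = WithTop.some 0} := by
      ext ω
      simp
    rw [this]
    exact hm 0
  | succ n ih =>
    rw [setOf_le_succ, indicator_union_of_disjoint (disjoint_setOf_le τ n)]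
    exact ih.add (hm (n + 1))

theorem abs_reward_le {t x : ℝ} {M : Ω → ℝ} {ω : Ω}
    (h : ∀ n : ℕ, |(x + walk X n ω) / (t + n)| ≤ M ω) : |reward X t x τ ω| ≤ M ω := by
  cases hτ : τ ω with
  | top =>
    rw [reward_of_eq_top hτ, abs_zero]
    exact (abs_nonneg _).trans (h 0)
  | coe k =>
    rw [reward_of_eq hτ]
    exact h k

variable [IsProbabilityMeasure P]

theorem integrable_reward (hindep : iIndepFun X P)
    (hident : ∀ i, IdentDistrib (X i) (X 0) P P) (hsub : HasSubgaussianMGF (X 0) 1 P)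
    (hτ : IsStoppingTime (walkFiltration hX) τ) {t : ℝ} (ht : 0 < t) (x : ℝ) :
    Integrable (reward X t x τ) P := by
  obtain ⟨M, hM, hb⟩ := exists_integrable_reward_bound hindep hident hsub ht x
  refine hM.mono' (measurable_reward hτ t x).aestronglyMeasurable ?_
  filter_upwards [hb] with ω hω using abs_reward_le hω

variable (P X) in
/-- The expected value of the strategy that follows `τ` up to the time `n` and is paid
`limitValue` at that time if `τ` has not stopped by then. -/
noncomputable def truncatedValue (τ : Ω → WithTop ℕ) (t x : ℝ) (n : ℕ) : ℝ :=
  (∫ ω in {ω | τ ω ≤ WithTop.some n}, reward X t x τ ω ∂P) +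
    ∫ ω in {ω | τ ω ≤ WithTop.some n}ᶜ, limitValue (P.map (X 0)) (t + n) (x + walk X n ω) ∂P

theorem limitValue_sub_truncatedValue_zero (hindep : iIndepFun X P)
    (hident : ∀ i, IdentDistrib (X i) (X 0) P P) (hsub : HasSubgaussianMGF (X 0) 1 P)
    (hτ : IsStoppingTime (walkFiltration hX) τ) {t : ℝ} (ht : 0 < t) (x : ℝ) :
    limitValue (P.map (X 0)) t x - truncatedValue P X τ t x 0 =
      ∫ ω in {ω | τ ω ≤ WithTop.some 0},
        (limitValue (P.map (X 0)) t x - reward X t x τ ω) ∂P := by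
  have hm := measurableSet_le hτ 0
  have hc := integrable_const (μ := P) (limitValue (P.map (X 0)) t x)
  have h := integral_add_compl hm hc
  rw [integral_sub hc.integrableOn
    (integrable_reward hindep hident hsub hτ ht x).integrableOn, truncatedValue]
  simp only [walk_zero, CharP.cast_eq_zero, add_zero]
  rw [integral_const (μ := P), probReal_univ, one_smul] at h
  linarith

/-- The loss of value in one step of a strategy is the expected loss from not stopping at the
time `n` plus the expected loss from stopping at the time `n + 1`. -/
theorem truncatedValue_sub_succ (hindep : iIndepFun X P)
    (hident : ∀ i, IdentDistrib (X i) (X 0) P P) (hsub : HasSubgaussianMGF (X 0) 1 P)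
    (hτ : IsStoppingTime (walkFiltration hX) τ) {t : ℝ} (ht : 0 < t) (x : ℝ) (n : ℕ) :
    truncatedValue P X τ t x n - truncatedValue P X τ t x (n + 1) =
      (∫ ω in {ω | τ ω ≤ WithTop.some n}ᶜ, (limitValue (P.map (X 0)) (t + n) (x + walk X n ω) -
        ∫ y, limitValue (P.map (X 0)) (t + n + 1) (x + walk X n ω + y) ∂(P.map (X 0))) ∂P) +
      ∫ ω in {ω | τ ω = WithTop.some (n + 1)},
        (limitValue (P.map (X 0)) (t + (n + 1 : ℕ)) (x + walk X (n + 1) ω) -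
          reward X t x τ ω) ∂P := by
  have hU := integrable_limitValue_walk hX hindep hident hsub ht x
  have hR := integrable_reward hindep hident hsub hτ ht x
  have hm := measurableSet_le hτ
  have hm' := measurableSet_eq hτ (n + 1)
  have hc : {ω | τ ω ≤ WithTop.some n}ᶜ =
      {ω | τ ω = WithTop.some (n + 1)} ∪ {ω | τ ω ≤ WithTop.some (n + 1)}ᶜ := by
    rw [setOf_le_succ, compl_union, union_inter_distrib_left, union_compl_self, inter_univ]
    exact (union_eq_right.2 (disjoint_setOf_le τ n).subset_compl_left).symm
  have hd : Disjoint {ω | τ ω = WithTop.some (n + 1)} {ω | τ ω ≤ WithTop.some (n + 1)}ᶜ := by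
    rw [disjoint_compl_right_iff_subset]
    exact fun ω hω => le_of_eq hω
  have hμP : IsProbabilityMeasure (P.map (X 0)) :=
    Measure.isProbabilityMeasure_map (hX 0).aemeasurable
  obtain ⟨hTi, h1⟩ := setIntegral_walk_succ hX hindep hident (hτ n).compl
    (measurable_limitValue (μ := P.map (X 0)) (t + (n + 1 : ℕ))) x (hU (n + 1))
  have h2 := setIntegral_union hd (hm (n + 1)).compl (hU (n + 1)).integrableOn
    (hU (n + 1)).integrableOn
  have h3 := setIntegral_union (disjoint_setOf_le τ n) hm' hR.integrableOn hR.integrableOn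
  rw [← hc] at h2
  rw [← setOf_le_succ] at h3
  have hcast : t + n + 1 = t + (n + 1 : ℕ) := by push_cast; ring
  rw [hcast, integral_sub (hU n).integrableOn hTi, integral_sub (hU (n + 1)).integrableOn
    hR.integrableOn, truncatedValue, truncatedValue, h3, ← h1, h2]
  ring

theorem truncatedValue_le (hindep : iIndepFun X P)
    (hident : ∀ i, IdentDistrib (X i) (X 0) P P) (hsub : HasSubgaussianMGF (X 0) 1 P)
    (hτ : IsStoppingTime (walkFiltration hX) τ) {t : ℝ} (ht : 0 < t) (x : ℝ) (n : ℕ) :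
    truncatedValue P X τ t x n ≤ limitValue (P.map (X 0)) t x := by
  have hμP : IsProbabilityMeasure (P.map (X 0)) :=
    Measure.isProbabilityMeasure_map (hX 0).aemeasurable
  have hμ := hasSubgaussianMGF_id_map hX hsub
  induction n with
  | zero =>
    rw [← sub_nonneg, limitValue_sub_truncatedValue_zero hindep hident hsub hτ ht]
    refine setIntegral_nonneg (measurableSet_le hτ 0) fun ω hω => sub_nonneg.2 ?_
    rw [reward_of_eq (n := 0) (le_antisymm hω (by simp))]
    simpa using div_le_limitValue hμ ht x
  | succ n ih =>
    refine le_trans ?_ ih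
    rw [← sub_nonneg, truncatedValue_sub_succ hindep hident hsub hτ ht]
    refine add_nonneg (setIntegral_nonneg (measurableSet_le hτ n).compl fun ω _ => ?_)
      (setIntegral_nonneg (measurableSet_eq hτ (n + 1)) fun ω hω => ?_)
    · rw [sub_nonneg, limitValue_eq_max hμ (by positivity : 0 < t + n)]
      exact le_max_right _ _
    · rw [sub_nonneg, reward_of_eq hω]
      exact div_le_limitValue hμ (by positivity) _

/-- No stopping time has a larger expected reward than `limitValue`. -/
theorem integral_reward_le (hindep : iIndepFun X P)
    (hident : ∀ i, IdentDistrib (X i) (X 0) P P) (hsub : HasSubgaussianMGF (X 0) 1 P)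
    (hτ : IsStoppingTime (walkFiltration hX) τ) {t : ℝ} (ht : 0 < t) (x : ℝ) :
    ∫ ω, reward X t x τ ω ∂P ≤ limitValue (P.map (X 0)) t x := by
  have hμP : IsProbabilityMeasure (P.map (X 0)) :=
    Measure.isProbabilityMeasure_map (hX 0).aemeasurable
  have hμ := hasSubgaussianMGF_id_map hX hsub
  obtain ⟨M, hM, hb⟩ := exists_integrable_reward_bound hindep hident hsub ht x
  let r : ℕ → Ω → ℝ := fun n ω => (x + walk X n ω) / (t + n)
  have hrm : ∀ n, Measurable (r n) := fun n => ((measurable_walk hX n).const_add x).div_const _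
  have hri : ∀ n, Integrable (r n) P := fun n => by
    refine hM.mono' (hrm n).aestronglyMeasurable ?_
    filter_upwards [hb] with ω hω using hω n
  have h1 : Tendsto (fun n : ℕ => ∫ ω, {ω | τ ω ≤ WithTop.some n}.indicator (reward X t x τ) ω ∂P)
      atTop (𝓝 (∫ ω, reward X t x τ ω ∂P)) := by
    refine tendsto_integral_of_dominated_convergence M (fun n =>
      ((measurable_reward hτ t x).indicator (measurableSet_le hτ n)).aestronglyMeasurable) hM
      (fun n => ?_) (ae_of_all _ (tendsto_indicator_reward τ t x))
    filter_upwards [hb] with ω hω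
    exact (norm_indicator_le_norm_self _ _).trans (abs_reward_le hω)
  -- on `{τ = ∞}` the rewards tend to the reward `0`
  have h2 : Tendsto (fun n : ℕ => ∫ ω, {ω | τ ω ≤ WithTop.some n}ᶜ.indicator (r n) ω ∂P) atTop
      (𝓝 (∫ _, (0 : ℝ) ∂P)) := by
    refine tendsto_integral_of_dominated_convergence M (fun n =>
      ((hrm n).indicator (measurableSet_le hτ n).compl).aestronglyMeasurable) hM (fun n => ?_) ?_
    · filter_upwards [hb] with ω hω
      exact (norm_indicator_le_norm_self _ _).trans (hω n)
    · filter_upwards [tendsto_walk_div hindep hident hsub ht x] with ω hω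
      refine squeeze_zero_norm (fun n => norm_indicator_le_norm_self _ _) ?_
      simpa [r] using hω.norm
  rw [integral_zero] at h2
  have h3 := h1.add h2
  rw [add_zero] at h3
  refine le_of_tendsto' h3 fun n => le_trans ?_ (truncatedValue_le hindep hident hsub hτ ht x n)
  rw [integral_indicator (measurableSet_le hτ n), integral_indicator (measurableSet_le hτ n).compl,
    truncatedValue]
  exact add_le_add le_rfl (integral_mono (hri n).integrableOn
    (integrable_limitValue_walk hX hindep hident hsub ht x n).integrableOn
    fun ω => div_le_limitValue hμ (by positivity) _)

/-- A stopping time that stops only where stopping is optimal, and goes on only where it is not,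
attains `limitValue`. -/
theorem integral_reward_eq (hindep : iIndepFun X P)
    (hident : ∀ i, IdentDistrib (X i) (X 0) P P) (hsub : HasSubgaussianMGF (X 0) 1 P)
    (hτ : IsStoppingTime (walkFiltration hX) τ) {t : ℝ} (ht : 0 < t) (x : ℝ)
    (hrest : ∀ ω (n : ℕ), τ ω = WithTop.some n →
      limitValue (P.map (X 0)) (t + n) (x + walk X n ω) = (x + walk X n ω) / (t + n))
    (hgo : ∀ ω (n : ℕ), ¬ τ ω ≤ WithTop.some n →
      limitValue (P.map (X 0)) (t + n) (x + walk X n ω) ≠ (x + walk X n ω) / (t + n)) :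
    ∫ ω, reward X t x τ ω ∂P = limitValue (P.map (X 0)) t x := by
  have hμP : IsProbabilityMeasure (P.map (X 0)) :=
    Measure.isProbabilityMeasure_map (hX 0).aemeasurable
  have hμ := hasSubgaussianMGF_id_map hX hsub
  have hR := integrable_reward hindep hident hsub hτ ht x
  obtain ⟨α, hα, -⟩ := existsUnique_isBoundaryConstant
  have heq : ∀ n, truncatedValue P X τ t x n = limitValue (P.map (X 0)) t x := by
    intro n
    induction n with
    | zero =>
      rw [eq_comm, ← sub_eq_zero, limitValue_sub_truncatedValue_zero hindep hident hsub hτ ht]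
      refine setIntegral_eq_zero_of_forall_eq_zero fun ω hω => sub_eq_zero.2 ?_
      have h0 : τ ω = WithTop.some 0 := le_antisymm hω (by simp)
      rw [reward_of_eq h0, ← hrest ω 0 h0]
      simp
    | succ n ih =>
      rw [← ih, eq_comm, ← sub_eq_zero, truncatedValue_sub_succ hindep hident hsub hτ ht]
      rw [setIntegral_eq_zero_of_forall_eq_zero, setIntegral_eq_zero_of_forall_eq_zero, add_zero]
      · intro ω hω
        rw [reward_of_eq hω, ← hrest ω (n + 1) hω, sub_self]
      · intro ω hω
        have h1 := limitValue_eq_max hμ (by positivity : 0 < t + n) (x + walk X n ω)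
        rw [sub_eq_zero]
        rcases max_choice ((x + walk X n ω) / (t + n))
          (∫ y, limitValue (P.map (X 0)) (t + n + 1) (x + walk X n ω + y) ∂(P.map (X 0)))
          with h2 | h2
        · exact absurd (h1.trans h2) (hgo ω n hω)
        · exact h1.trans h2
  refine le_antisymm (integral_reward_le hindep hident hsub hτ ht x) ?_
  have h1 : Tendsto (fun n : ℕ => ∫ ω in {ω | τ ω ≤ WithTop.some n}, reward X t x τ ω ∂P) atTop
      (𝓝 (∫ ω, reward X t x τ ω ∂P)) := by
    simp_rw [← integral_indicator (measurableSet_le hτ _)]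
    refine tendsto_integral_of_dominated_convergence (fun ω => ‖reward X t x τ ω‖) (fun n =>
      ((measurable_reward hτ t x).indicator (measurableSet_le hτ n)).aestronglyMeasurable) hR.norm
      (fun n => ae_of_all _ fun ω => norm_indicator_le_norm_self _ _)
      (ae_of_all _ (tendsto_indicator_reward τ t x))
  have h2 : Tendsto (fun n : ℕ => α / √(t + n)) atTop (𝓝 0) :=
    tendsto_const_nhds.div_atTop (Real.tendsto_sqrt_atTop.comp
      (tendsto_atTop_add_const_left _ _ tendsto_natCast_atTop_atTop))
  have h3 := h1.add h2
  rw [add_zero] at h3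
  refine ge_of_tendsto' h3 fun n => ?_
  rw [← heq n, truncatedValue]
  gcongr
  have hα0 : 0 ≤ α / √(t + n) := div_nonneg hα.mem_Ioo.1.le (Real.sqrt_nonneg _)
  calc _ ≤ ∫ ω in {ω | τ ω ≤ WithTop.some n}ᶜ, α / √(t + n) ∂P :=
        setIntegral_mono_on (integrable_limitValue_walk hX hindep hident hsub ht x n).integrableOn
          (integrable_const _).integrableOn (measurableSet_le hτ n).compl fun ω hω =>
          limitValue_le_of_ne hμ hα (by positivity) (hgo ω n hω)
    _ ≤ α / √(t + n) := by
        rw [setIntegral_const, smul_eq_mul]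
        exact mul_le_of_le_one_left hα0 measureReal_le_one

end StoppingTime

/-! ### The stopping set -/

theorem timeSpace_apply (X : ℕ → Ω → ℝ) (t x : ℝ) (n : ℕ) (ω : Ω) :
    timeSpace X t x n ω = (t + n, x + walk X n ω) := rfl

variable [IsProbabilityMeasure P]

/-- The first time at which the reward equals `limitValue`. -/
noncomputable def contactTime (P : Measure Ω) (X : ℕ → Ω → ℝ) (t x : ℝ) : Ω → WithTop ℕ :=
  hittingAfter (timeSpace X t x) {p : ℝ × ℝ | limitValue (P.map (X 0)) p.1 p.2 = p.2 / p.1} 0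

theorem isStoppingTime_contactTime (hX : ∀ i, Measurable (X i)) (t x : ℝ) :
    IsStoppingTime (walkFiltration hX) (contactTime P X t x) := by
  have hμP : IsProbabilityMeasure (P.map (X 0)) :=
    Measure.isProbabilityMeasure_map (hX 0).aemeasurable
  intro n
  have : {ω | contactTime P X t x ω ≤ WithTop.some n} = ⋃ j ∈ Iic n, (fun ω => x + walk X j ω) ⁻¹'
      {y | limitValue (P.map (X 0)) (t + j) y = y / (t + j)} := by
    ext ω
    rw [mem_ofPred_eq, contactTime, hittingAfter_le_iff]
    simp [timeSpace_apply]
  change MeasurableSet[walkFiltration hX n] {ω | contactTime P X t x ω ≤ WithTop.some n}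
  rw [this]
  refine MeasurableSet.biUnion (to_countable _) fun j hj => ?_
  have hS : Measurable[walkFiltration hX n] (walk X j) :=
    measurable_iff_comap_le.2 (le_iSup₂_of_le j hj le_rfl)
  exact (hS.const_add x) (measurableSet_eq_fun (measurable_limitValue _)
    (measurable_id.div_const _))

theorem integral_reward_contactTime (hX : ∀ i, Measurable (X i)) (hindep : iIndepFun X P)
    (hident : ∀ i, IdentDistrib (X i) (X 0) P P) (hsub : HasSubgaussianMGF (X 0) 1 P)
    {t : ℝ} (ht : 0 < t) (x : ℝ) :
    ∫ ω, reward X t x (contactTime P X t x) ω ∂P = limitValue (P.map (X 0)) t x := by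
  refine integral_reward_eq hindep hident hsub (isStoppingTime_contactTime hX t x) ht x
    (fun ω n h => ?_) fun ω n h => ?_
  · have hmem := hittingAfter_mem_set_of_ne_top (h.trans_ne (WithTop.coe_ne_top (a := n)))
    have hu : (contactTime P X t x ω).untopA = n := by rw [h]; rfl
    rw [contactTime] at hu
    rw [hu] at hmem
    exact hmem
  · exact notMem_of_lt_hittingAfter (u := timeSpace X t x) (not_le.1 h) n.zero_le

/-- The value function is the limit of the values with finite horizon. -/
theorem value_eq_limitValue (hX : ∀ i, Measurable (X i)) (hindep : iIndepFun X P)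
    (hident : ∀ i, IdentDistrib (X i) (X 0) P P) (hsub : HasSubgaussianMGF (X 0) 1 P)
    {t : ℝ} (ht : 0 < t) (x : ℝ) : value hX P t x = (limitValue (P.map (X 0)) t x : ℝ) := by
  refine le_antisymm (iSup₂_le fun τ hτ => ?_) ?_
  · exact EReal.coe_le_coe_iff.2 (integral_reward_le hindep hident hsub hτ ht x)
  · rw [← integral_reward_contactTime hX hindep hident hsub ht x]
    exact le_iSup₂ (f := fun (τ : Ω → WithTop ℕ) (_ : IsStoppingTime (walkFiltration hX) τ) =>
      ((∫ ω, reward X t x τ ω ∂P : ℝ) : EReal)) _ (isStoppingTime_contactTime hX t x)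

theorem mem_stoppingSet_iff (hX : ∀ i, Measurable (X i)) (hindep : iIndepFun X P)
    (hident : ∀ i, IdentDistrib (X i) (X 0) P P) (hsub : HasSubgaussianMGF (X 0) 1 P)
    {t : ℝ} (ht : 0 < t) (x : ℝ) :
    (t, x) ∈ stoppingSet hX P ↔ limitValue (P.map (X 0)) t x = x / t := by
  rw [stoppingSet, mem_ofPred_eq, value_eq_limitValue hX hindep hident hsub ht]
  simp only [ht, true_and]
  exact EReal.coe_eq_coe_iff

theorem entranceTime_eq_contactTime (hX : ∀ i, Measurable (X i)) (hindep : iIndepFun X P)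
    (hident : ∀ i, IdentDistrib (X i) (X 0) P P) (hsub : HasSubgaussianMGF (X 0) 1 P)
    {t : ℝ} (ht : 0 < t) (x : ℝ) : entranceTime hX P t x = contactTime P X t x := by
  ext ω : 1
  refine eq_of_forall_ge_iff fun c => ?_
  cases c with
  | top => simp
  | coe n =>
    rw [entranceTime, contactTime, hittingAfter_le_iff, hittingAfter_le_iff]
    refine exists_congr fun j => and_congr_right fun _ => ?_
    rw [timeSpace_apply, mem_stoppingSet_iff hX hindep hident hsub (by positivity)]
    rfl

theorem isOptimal_entranceTime (hX : ∀ i, Measurable (X i)) (hindep : iIndepFun X P)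
    (hident : ∀ i, IdentDistrib (X i) (X 0) P P) (hsub : HasSubgaussianMGF (X 0) 1 P)
    {t : ℝ} (ht : 0 < t) (x : ℝ) : IsOptimal hX P t x (entranceTime hX P t x) := by
  rw [entranceTime_eq_contactTime hX hindep hident hsub ht]
  refine ⟨isStoppingTime_contactTime hX t x, ?_⟩
  rw [integral_reward_contactTime hX hindep hident hsub ht,
    value_eq_limitValue hX hindep hident hsub ht]

theorem entranceTime_le_boundaryTime (hX : ∀ i, Measurable (X i)) (hindep : iIndepFun X P)
    (hident : ∀ i, IdentDistrib (X i) (X 0) P P) (hsub : HasSubgaussianMGF (X 0) 1 P)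
    {t : ℝ} (ht : 0 < t) (x : ℝ) {α : ℝ} (hα : IsBoundaryConstant α) (ω : Ω) :
    entranceTime hX P t x ω ≤ boundaryTime X α t x ω := by
  have hμP : IsProbabilityMeasure (P.map (X 0)) :=
    Measure.isProbabilityMeasure_map (hX 0).aemeasurable
  refine le_of_forall_ge fun c hc => ?_
  cases c with
  | top => exact le_top
  | coe n =>
    rw [boundaryTime, hittingAfter_le_iff] at hc
    obtain ⟨j, hj, hmem⟩ := hc
    rw [entranceTime, hittingAfter_le_iff]
    refine ⟨j, ⟨j.zero_le, hj.2⟩, ?_⟩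
    have htj : 0 < t + j := by positivity
    rw [timeSpace_apply, mem_stoppingSet_iff hX hindep hident hsub htj]
    exact limitValue_eq_div_of_boundary_le (hasSubgaussianMGF_id_map hX hsub) hα htj hmem

theorem entranceTime_eq_zero (hX : ∀ i, Measurable (X i))
    (hident : ∀ i, IdentDistrib (X i) (X 0) P P) (h0 : ∀ᵐ ω ∂P, X 0 ω = 0)
    {t x : ℝ} (ht : 0 < t) (hx : 0 ≤ x) (ω : Ω) : entranceTime hX P t x ω = 0 := by
  have hall : ∀ᵐ ω ∂P, ∀ i, X i ω = 0 := by
    refine ae_all_iff.2 fun i => ?_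
    exact (hident i).symm.ae_snd (p := fun y => y = 0) (measurableSet_singleton 0) h0
  have hle : ∀ τ : Ω → WithTop ℕ, ∫ ω, reward X t x τ ω ∂P ≤ x / t := by
    intro τ
    have hxt : 0 ≤ x / t := by positivity
    by_cases hi : Integrable (reward X t x τ) P
    · have : ∫ ω, reward X t x τ ω ∂P ≤ ∫ _, x / t ∂P := by
        refine integral_mono_ae hi (integrable_const _) ?_
        filter_upwards [hall] with ω hω
        cases h : τ ω with
        | top => rwa [reward_of_eq_top h]
        | coe n =>
          rw [reward_of_eq h]
          simp only [walk, hω, Finset.sum_const_zero, add_zero]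
          gcongr
          linarith [(n.cast_nonneg : (0 : ℝ) ≤ n)]
      simpa using this
    · rwa [integral_undef hi]
  have hmem : (t, x) ∈ stoppingSet hX P := by
    refine ⟨ht, le_antisymm (iSup₂_le fun τ _ => EReal.coe_le_coe_iff.2 (hle τ)) ?_⟩
    refine le_trans (le_of_eq ?_) (le_iSup₂ (f := fun (τ : Ω → WithTop ℕ)
      (_ : IsStoppingTime (walkFiltration hX) τ) => ((∫ ω, reward X t x τ ω ∂P : ℝ) : EReal))
      (fun _ => WithTop.some 0) (isStoppingTime_const _ 0))
    have : ∀ ω, reward X t x (fun _ => WithTop.some 0) ω = x / t := fun ω => by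
      rw [reward_of_eq (τ := fun _ => WithTop.some 0) (n := 0) rfl]
      simp
    simp_rw [this]
    simp
  refine le_antisymm (hittingAfter_le_of_mem (i := 0) le_rfl ?_) (by simp)
  rw [timeSpace_apply]
  simpa using hmem

/-! ### Finiteness of the boundary time -/

/-- The sequences with `limsup s_n / √n > c`. The margin `1 / (k + 1)` makes the condition invariant
under bounded changes of the sequence, and hence a tail event for the random walk. -/
def sqrtExceeds (c : ℝ) : Set (ℕ → ℝ) :=
  {s | ∃ k : ℕ, ∃ᶠ n : ℕ in atTop, (c + 1 / (k + 1)) * √n < s n}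

theorem mem_sqrtExceeds_of_le_add {c d : ℝ} {s s' : ℕ → ℝ}
    (h : ∀ᶠ n in atTop, s n ≤ s' n + d) (hs : s ∈ sqrtExceeds c) : s' ∈ sqrtExceeds c := by
  obtain ⟨k, hk⟩ := hs
  refine ⟨k + 1, ?_⟩
  set e : ℝ := 1 / (k + 1) - 1 / ((k + 1 : ℕ) + 1) with he
  have he0 : 0 < e := by
    rw [he, sub_pos]
    apply one_div_lt_one_div_of_lt <;> push_cast <;> linarith [(k.cast_nonneg : (0 : ℝ) ≤ k)]
  have hd : ∀ᶠ n : ℕ in atTop, d ≤ e * √n :=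
    ((Real.tendsto_sqrt_atTop.comp tendsto_natCast_atTop_atTop).const_mul_atTop
      he0).eventually_ge_atTop d
  refine (hk.and_eventually (h.and hd)).mono fun n hn => ?_
  obtain ⟨h1, h2, h3⟩ := hn
  have : e * √n = (c + 1 / (k + 1)) * √n - (c + 1 / ((k + 1 : ℕ) + 1)) * √n := by
    rw [he]
    ring
  linarith

theorem measurableSet_sqrtExceeds {m : MeasurableSpace Ω} (c : ℝ) {Y : ℕ → Ω → ℝ}
    (hY : ∀ n, Measurable (Y n)) : MeasurableSet {ω | (fun n => Y n ω) ∈ sqrtExceeds c} := by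
  have : {ω | (fun n => Y n ω) ∈ sqrtExceeds c} =
      ⋃ k : ℕ, limsup (fun n : ℕ => {ω | (c + 1 / (k + 1)) * √n < Y n ω}) atTop := by
    ext ω
    simp [sqrtExceeds, mem_limsup_iff_frequently_mem]
  rw [this]
  exact MeasurableSet.iUnion fun k => MeasurableSet.measurableSet_limsup fun n =>
    measurableSet_lt measurable_const (hY n)

theorem measurableSet_limsup_sqrtExceeds_walk (X : ℕ → Ω → ℝ) (c : ℝ) :
    MeasurableSet[limsup (fun i => MeasurableSpace.comap (X i) inferInstance) atTop]
      {ω | (fun n => walk X n ω) ∈ sqrtExceeds c} := by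
  rw [limsup_eq_iInf_iSup_of_nat, MeasurableSpace.measurableSet_iInf]
  intro N
  have heq : {ω | (fun n => walk X n ω) ∈ sqrtExceeds c} =
      {ω | (fun n => ∑ i ∈ Finset.Ico N n, X i ω) ∈ sqrtExceeds c} := by
    have h : ∀ ω, ∀ᶠ n in atTop, walk X n ω = walk X N ω + ∑ i ∈ Finset.Ico N n, X i ω := by
      intro ω
      filter_upwards [eventually_ge_atTop N] with n hn
      exact (Finset.sum_range_add_sum_Ico _ hn).symm
    ext ω
    exact ⟨mem_sqrtExceeds_of_le_add (d := walk X N ω) ((h ω).mono fun n hn => by linarith),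
      mem_sqrtExceeds_of_le_add (d := -walk X N ω) ((h ω).mono fun n hn => by linarith)⟩
  rw [heq]
  refine @measurableSet_sqrtExceeds Ω (⨆ i ≥ N, MeasurableSpace.comap (X i) inferInstance) c _
    fun n => Finset.measurable_fun_sum _ fun i hi => measurable_iff_comap_le.2 ?_
  exact le_iSup₂ (f := fun i (_ : i ≥ N) => MeasurableSpace.comap (X i) _) i
    (Finset.mem_Ico.1 hi).1

theorem variance_ne_zero (hsub : HasSubgaussianMGF (X 0) 1 P)
    (h0 : ¬ ∀ᵐ ω ∂P, X 0 ω = 0) : Var[X 0; P] ≠ 0 := by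
  intro hv
  have := ae_eq_integral_of_variance_eq_zero (hsub.memLp 2) hv
  rw [integral_eq_zero_of_hasSubgaussianMGF hsub] at this
  exact h0 this

/-- By the central limit theorem, the probabilities of `S_n > c √n` stay away from `0`. -/
theorem measure_limsup_lt_walk_ne_zero (hX : ∀ i, Measurable (X i))
    (hindep : iIndepFun X P) (hident : ∀ i, IdentDistrib (X i) (X 0) P P)
    (hsub : HasSubgaussianMGF (X 0) 1 P) (h0 : ¬ ∀ᵐ ω ∂P, X 0 ω = 0) (c : ℝ) :
    P {ω | ∃ᶠ n : ℕ in atTop, c * √n < walk X n ω} ≠ 0 := by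
  set v := Var[X 0; P].toNNReal with hv
  have hv0 : v ≠ 0 := by
    rw [hv, Ne, Real.toNNReal_eq_zero, not_le]
    exact lt_of_le_of_ne (variance_nonneg _ _) (variance_ne_zero hsub h0).symm
  have hclt := (tendstoInDistribution_inv_sqrt_mul_sum_sub (Y := id)
    (P' := gaussianReal 0 v) HasLaw.id (hsub.memLp 2) hindep hident).tendsto
  have hle := ProbabilityMeasure.le_liminf_measure_open_of_tendsto hclt (isOpen_Ioi (a := c))
  have hpos : 0 < gaussianReal 0 v (Ioi c) := by
    have := (gaussianReal_absolutelyContinuous' 0 hv0).isOpenPosMeasure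
    exact isOpen_Ioi.measure_pos _ nonempty_Ioi
  intro hz
  have hlim : Tendsto (fun n : ℕ => P {ω | c * √n < walk X n ω}) atTop (𝓝 (P ∅)) := by
    refine tendsto_measure_of_ae_tendsto_indicator_of_isFiniteMeasure atTop MeasurableSet.empty
      (fun n => measurableSet_lt measurable_const (measurable_walk hX n)) ?_
    filter_upwards [measure_eq_zero_iff_ae_notMem.1 hz] with ω hω
    filter_upwards [not_frequently.1 hω] with n hn
    simpa using hn
  rw [measure_empty] at hlim
  have heq : ∀ᶠ n : ℕ in atTop, P {ω | c * √n < walk X n ω} =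
      P.map (fun ω => (√n)⁻¹ * (∑ k ∈ Finset.range n, X k ω - n * P[X 0])) (Ioi c) := by
    filter_upwards [eventually_gt_atTop 0] with n hn
    have hs : 0 < √(n : ℝ) := Real.sqrt_pos.2 (by exact_mod_cast hn)
    rw [integral_eq_zero_of_hasSubgaussianMGF hsub, Measure.map_apply (by fun_prop)
      measurableSet_Ioi]
    congr 1
    ext ω
    simp only [mem_ofPred_eq, mem_preimage, mem_Ioi, mul_zero, sub_zero, walk]
    rw [← div_eq_inv_mul, lt_div_iff₀ hs]
  have hlim' := (hlim.congr' heq).liminf_eq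
  simp only [ProbabilityMeasure.coe_mk, Measure.map_id] at hle
  rw [hlim'] at hle
  exact absurd hle (not_le.2 hpos)

/-- For nondegenerate steps, `S_n > c √n` infinitely often, by the Kolmogorov zero-one law. -/
theorem ae_frequently_lt_walk (hX : ∀ i, Measurable (X i))
    (hindep : iIndepFun X P) (hident : ∀ i, IdentDistrib (X i) (X 0) P P)
    (hsub : HasSubgaussianMGF (X 0) 1 P) (h0 : ¬ ∀ᵐ ω ∂P, X 0 ω = 0) (c : ℝ) :
    ∀ᵐ ω ∂P, ∃ᶠ n : ℕ in atTop, c * √n < walk X n ω := by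
  have h01 := measure_zero_or_one_of_measurableSet_limsup_atTop (fun i => (hX i).comap_le)
    hindep.iIndep (measurableSet_limsup_sqrtExceeds_walk X c)
  have hss : {ω | ∃ᶠ n : ℕ in atTop, (c + 1) * √n < walk X n ω} ⊆
      {ω | (fun n => walk X n ω) ∈ sqrtExceeds c} := fun ω hω => ⟨0, by simpa using hω⟩
  have hne : P {ω | (fun n => walk X n ω) ∈ sqrtExceeds c} ≠ 0 := fun hz =>
    measure_limsup_lt_walk_ne_zero hX hindep hident hsub h0 (c + 1) (measure_mono_null hss hz)
  have h1 := h01.resolve_left hne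
  have hae : ∀ᵐ ω ∂P, ω ∈ {ω | (fun n => walk X n ω) ∈ sqrtExceeds c} :=
    (prob_compl_eq_zero_iff (measurableSet_sqrtExceeds c fun n => measurable_walk hX n)).2 h1
  filter_upwards [hae] with ω hω
  obtain ⟨k, hk⟩ := hω
  refine hk.mono fun n hn => lt_of_le_of_lt ?_ hn
  gcongr
  have : (0 : ℝ) ≤ 1 / (k + 1) := by positivity
  linarith

theorem ae_boundaryTime_lt_top (hX : ∀ i, Measurable (X i))
    (hindep : iIndepFun X P) (hident : ∀ i, IdentDistrib (X i) (X 0) P P)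
    (hsub : HasSubgaussianMGF (X 0) 1 P) (h0 : ¬ ∀ᵐ ω ∂P, X 0 ω = 0) {α : ℝ} (hα : 0 ≤ α)
    {t : ℝ} (ht : 0 < t) (x : ℝ) : ∀ᵐ ω ∂P, boundaryTime X α t x ω < ⊤ := by
  filter_upwards [ae_frequently_lt_walk hX hindep hident hsub h0 (α + 1)] with ω hω
  have hlarge : ∀ᶠ n : ℕ in atTop, α * √t - x ≤ √n :=
    (Real.tendsto_sqrt_atTop.comp tendsto_natCast_atTop_atTop).eventually_ge_atTop _
  obtain ⟨n, hn, hl, hn1⟩ := (hω.and_eventually (hlarge.and (eventually_ge_atTop 1))).exists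
  refine (hittingAfter_le_of_mem hn1 ?_).trans_lt (WithTop.coe_lt_top n)
  have hsqrt : α * √(t + n) ≤ α * √t + α * √n := by
    rw [← mul_add]
    gcongr
    rw [Real.sqrt_le_left (by positivity)]
    nlinarith [Real.sq_sqrt ht.le, Real.sq_sqrt (n.cast_nonneg : (0 : ℝ) ≤ n),
      mul_nonneg (Real.sqrt_nonneg t) (Real.sqrt_nonneg n)]
  change α * √(t + n) ≤ x + walk X n ω
  linarith

end ChowRobbins

theorem corollary2p5 {Ω : Type*} {mΩ : MeasurableSpace Ω} (P : Measure Ω) [IsProbabilityMeasure P]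
    (X : ℕ → Ω → ℝ) (hX : ∀ i, Measurable (X i))
    (hindep : iIndepFun X P) (hident : ∀ i, IdentDistrib (X i) (X 0) P P)
    (hsub : HasSubgaussianMGF (X 0) 1 P) :
    (∃! α : ℝ, ChowRobbins.IsBoundaryConstant α) ∧
    ∀ t x : ℝ, 0 < t →
      -- the expectation exists for every stopping time
      (∀ τ : Ω → WithTop ℕ, IsStoppingTime (ChowRobbins.walkFiltration hX) τ →
        Integrable (ChowRobbins.reward X t x τ) P) ∧
      -- there is an optimal stopping time that is almost surely finite
      (¬ (∀ᵐ ω ∂P, X 0 ω = 0) ∨ 0 ≤ x →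
        (∃ τ : Ω → WithTop ℕ, ChowRobbins.IsOptimal hX P t x τ ∧ ∀ᵐ ω ∂P, τ ω < ⊤) ∧
        -- and the first entrance time into the stopping set is one
        ChowRobbins.IsOptimal hX P t x (ChowRobbins.entranceTime hX P t x) ∧
        ∀ᵐ ω ∂P, ChowRobbins.entranceTime hX P t x ω < ⊤) ∧
      ∀ α : ℝ, ChowRobbins.IsBoundaryConstant α →
        (∀ ω, ChowRobbins.entranceTime hX P t x ω ≤ ChowRobbins.boundaryTime X α t x ω) ∧
        (¬ (∀ᵐ ω ∂P, X 0 ω = 0) → ∀ᵐ ω ∂P, ChowRobbins.boundaryTime X α t x ω < ⊤) := by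
  refine ⟨ChowRobbins.existsUnique_isBoundaryConstant, fun t x ht => ⟨fun τ hτ =>
    ChowRobbins.integrable_reward hindep hident hsub hτ ht x, fun h => ?_, fun α hα =>
    ⟨ChowRobbins.entranceTime_le_boundaryTime hX hindep hident hsub ht x hα, fun h0 =>
      ChowRobbins.ae_boundaryTime_lt_top hX hindep hident hsub h0 hα.mem_Ioo.1.le ht x⟩⟩⟩
  have hopt := ChowRobbins.isOptimal_entranceTime hX hindep hident hsub ht x
  have hfin : ∀ᵐ ω ∂P, ChowRobbins.entranceTime hX P t x ω < ⊤ := by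
    by_cases h0 : ∀ᵐ ω ∂P, X 0 ω = 0
    · refine Filter.Eventually.of_forall fun ω => ?_
      rw [ChowRobbins.entranceTime_eq_zero hX hident h0 ht (h.resolve_left (not_not.2 h0))]
      exact WithTop.coe_lt_top 0
    · obtain ⟨α, hα, -⟩ := ChowRobbins.existsUnique_isBoundaryConstant
      filter_upwards [ChowRobbins.ae_boundaryTime_lt_top hX hindep hident hsub h0
        hα.mem_Ioo.1.le ht x] with ω hω
      exact (ChowRobbins.entranceTime_le_boundaryTime hX hindep hident hsub ht x hα ω).trans_lt hω
  exact ⟨⟨_, hopt, hfin⟩, hopt, hfin⟩
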